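/- Let $m$ be a $\sigma$-finite (more generally s-finite) reference measure on $\mathbb{R}^d$, and let $p(y\mid x)$, $q(y\mid x)$ be jointly measurable transition densities with respect to $m$, with Markov kernels $P(x,A)=\int_A p(y\mid x)\,dm(y)$ (pre-change) and $Q(x,A)=\int_A q(y\mid x)\,dm(y)$ (post-change). For a pair $B=(x,y)$ put $$s(B)=S_H(y,x;p)-S_H(y,x;q),\qquad S_H(y,x;p)=\tfrac12\|\nabla_y\log p(y\mid x)\|^2+\Delta_y\log p(y\mid x),$$ and assume that $s$ is measurable. For $M>0$ let $\varphi(u)=\max(-M,\min(u,M))$ be truncation at level $M$, and let $\|\varphi\|=\sup_{(x,y)}|\varphi(s(x,y))|$. A Markov kernel $K$ satisfies Doeblin's condition with constants $l\in\mathbb{N}$, $l\ge1$, and $\lambda>0$ if there is a probability measure $\phi$ with $K^l(x,\cdot)\ge\lambda\,\phi(\cdot)$ for all $x$. Assume that $Q$ satisfies Doeblin's condition (with some constants) and has stationary distribution $\pi_q$. Let $(\tilde l,\tilde\lambda)$ be constants with which the kernel of the pair process $B_t=(X_{t-1},X_t)$ (where $X$ has kernel $Q$) satisfies Doeblin's condition,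 and set $$\mu=\frac{2(\tilde l+1)\|\varphi\|}{\tilde\lambda}.$$ Let the change point be $\nu=1$: the observations $X_0,X_1,X_2,\dots$ are such that $X_0$ has an arbitrary initial law and, for every $n\ge1$, the conditional law of $X_n$ given $X_0,\dots,X_{n-1}$ is $Q(X_{n-1},\cdot)$; write $\mathbb{E}_1$ for the expectation under this law. Let $$T(b)=\inf\Big\{n\ge1:\max_{1\le k\le n}\sum_{i=k}^n\varphi(s(B_i))\ge b\Big\}\qquad(\inf\emptyset=\infty).$$ Assume that the truncated drift $I=\int\!\!\int\varphi(s(x,y))\,Q(x,dy)\,\pi_q(dx)$, i.e. the value of $\mathbb{E}_1[\varphi(s(B_t))]$ in the stationary regime, is positive, and put $n_0=n_0(b)=\lfloor (b+\mu)/I\rfloor$. Then, with the model and $M$ fixed, $\mathbb{E}_1[T(b)]\le 1+n_0(1+o(1))$ as $n_0\to\infty$. More precisely, there is a sequence $\varepsilon:\mathbb{N}\to\mathbb{R}$ with $\varepsilon(n)\to0$ as $n\to\infty$ such that, for every threshold $b>0$, $$\mathbb{E}_1[T(b)]\le 1+n_0(b)\,\bigl(1+\varepsilon(n_0(b))\bigr).$$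 -/

import Mathlib

open MeasureTheory ProbabilityTheory Filter Topology
open scoped ENNReal

noncomputable section

/-- A transition density `p(y | x)` on `ℝᵈ` with respect to the reference measure `m`:
`toFun x y` is `p(y | x)`. -/
structure TransitionDensity {d : ℕ} (m : Measure (EuclideanSpace ℝ (Fin d))) where
  toFun : EuclideanSpace ℝ (Fin d) → EuclideanSpace ℝ (Fin d) → ℝ
  nonneg : ∀ x y, 0 ≤ toFun x y
  measurable : Measurable (Function.uncurry toFun)
  lintegral_eq_one : ∀ x, ∫⁻ y, ENNReal.ofReal (toFun x y) ∂m = 1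

namespace TransitionDensity

variable {d : ℕ} {m : Measure (EuclideanSpace ℝ (Fin d))}

/-- The Markov kernel `P(x, A) = ∫_A p(y | x) dm(y)`. -/
def kernel [SFinite m] (p : TransitionDensity m) :
    Kernel (EuclideanSpace ℝ (Fin d)) (EuclideanSpace ℝ (Fin d)) :=
  (Kernel.const (EuclideanSpace ℝ (Fin d)) m).withDensity
    (fun x y => ENNReal.ofReal (p.toFun x y))

instance [SFinite m] (p : TransitionDensity m) : IsMarkovKernel p.kernel :=
  ⟨fun x => ⟨by
    rw [kernel, Kernel.withDensity_apply' _ p.measurable.ennreal_ofReal]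
    simpa using p.lintegral_eq_one x⟩⟩

/-- The conditional Hyvärinen score
`S_H(y, x; p) = ½ ‖∇_y log p(y | x)‖² + Δ_y log p(y | x)`. -/
def hyvarinenScore (p : TransitionDensity m) (y x : EuclideanSpace ℝ (Fin d)) : ℝ :=
  1 / 2 * ‖gradient (fun y' => Real.log (p.toFun x y')) y‖ ^ 2
    + Laplacian.laplacian (fun y' => Real.log (p.toFun x y')) y

end TransitionDensity

/-- The Hyvärinen score difference `s(B) = S_H(B; p) - S_H(B; q)` at a pair `B = (x, y)` of
consecutive observations (`x` first, then `y`). -/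
def scoreDiff {d : ℕ} {m : Measure (EuclideanSpace ℝ (Fin d))} (p q : TransitionDensity m)
    (B : EuclideanSpace ℝ (Fin d) × EuclideanSpace ℝ (Fin d)) : ℝ :=
  p.hyvarinenScore B.2 B.1 - q.hyvarinenScore B.2 B.1

/-- The truncation function `φ` at level `M`. -/
def truncate (M x : ℝ) : ℝ :=
  if |x| ≤ M then x else if M < x then M else -M

/-- `φ(s(B))`, the truncated score difference at a pair `B`. -/
def truncScore {d : ℕ} {m : Measure (EuclideanSpace ℝ (Fin d))} (p q : TransitionDensity m)
    (M : ℝ) (B : EuclideanSpace ℝ (Fin d) × EuclideanSpace ℝ (Fin d)) : ℝ :=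
  truncate M (scoreDiff p q B)

/-- Doeblin's condition with constants `(l, lam)`: for some probability measure `φ`,
`κ^l(x, ·) ≥ lam φ(·)` for all `x`. -/
def SatisfiesDoeblin {S : Type*} [MeasurableSpace S] (κ : Kernel S S) (l : ℕ) (lam : ℝ) : Prop :=
  1 ≤ l ∧ 0 < lam ∧ ∃ φ : Measure S, IsProbabilityMeasure φ ∧
    ∀ x : S, ENNReal.ofReal lam • φ ≤ (κ ^ l) x

/-- The transition kernel of the pair chain `B_n = (X_{n-1}, X_n)` when `X` has kernel `κ`:
from `(x, x')` it moves to `(x', y)` with `y ∼ κ(x', ·)`. -/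
def pairKernel {S : Type*} [MeasurableSpace S] (κ : Kernel S S) : Kernel (S × S) (S × S) :=
  Kernel.deterministic Prod.snd measurable_snd ×ₖ κ.comap Prod.snd measurable_snd

/-- `X` is, under `Pr`, a process with initial law `ρ` and change point `ν`: conditionally on
`X_0, …, X_{n-1}`, the law of `X_n` is `P(X_{n-1}, ·)` for `1 ≤ n < ν` and `Q(X_{n-1}, ·)` for
`n ≥ max ν 1`. -/
structure IsChangePointProcess {S Ω : Type*} [MeasurableSpace S] [MeasurableSpace Ω]
    (P Q : Kernel S S) (ρ : Measure S) (ν : ℕ) (X : ℕ → Ω → S) (Pr : Measure Ω) : Prop where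
  measurable : ∀ n, Measurable (X n)
  initial : HasLaw (X 0) ρ Pr
  transition : ∀ n : ℕ,
    HasCondDistrib (X (n + 1)) (fun ω (i : Fin (n + 1)) => X i ω)
      ((if n + 1 < ν then P else Q).comap (fun h : Fin (n + 1) → S => h (Fin.last n))
        (measurable_pi_apply _)) Pr

/-- The CUSUM stopping time with increments `f(B_i)`, `B_i = (X_{i-1}, X_i)`, and threshold `b`:
`inf {n ≥ 1 : max_{1 ≤ k ≤ n} ∑_{i=k}^n f(B_i) ≥ b}`, equal to `∞` if there is no such `n`. -/
def cusumTime {S Ω : Type*} (f : S × S → ℝ) (X : ℕ → Ω → S) (b : ℝ) (ω : Ω) : ℕ∞ :=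
  ⨅ (n : ℕ) (_ : ∃ k : ℕ, 1 ≤ k ∧ k ≤ n ∧ b ≤ ∑ i ∈ Finset.Icc k n, f (X (i - 1) ω, X i ω)),
    (n : ℕ∞)

/-- The stationary mean `𝔼[f(X_{t-1}, X_t)]`, where `X_{t-1} ∼ π` and `X_t ∼ κ(X_{t-1}, ·)`. -/
def stationaryDrift {S : Type*} [MeasurableSpace S] (π : Measure S) (κ : Kernel S S)
    (f : S × S → ℝ) : ℝ :=
  ∫ B, f B ∂(π ⊗ₘ κ)

/-- The constant `2 (l + 1) ‖f‖ / lam`, where `‖f‖` is the supremum norm. -/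
def hoeffdingConst {S : Type*} (f : S × S → ℝ) (l : ℕ) (lam : ℝ) : ℝ :=
  2 * ((l : ℝ) + 1) * (⨆ B, |f B|) / lam

end

/-!
Write `f = φ ∘ s`, `F = ‖f‖`, `I` for the stationary drift of `f`, and
`S_n = ∑_{i ≤ n} f(X_{i-1}, X_i)`. Taking `k = 1` in the maximum, the CUSUM time is at most the first
`n` with `S_n ≥ b`, so its expectation is at most `∑_n Pr(S_k < b for all k ≤ n)`. A Wald type
argument bounds this sum.

Doeblin's condition makes `κ^l` contract oscillations by the factor `1 - lam`
(`SatisfiesDoeblin.exists_integral_mem_Icc`), so `κ^t h` converges to its stationary mean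
geometrically (`SatisfiesDoeblin.abs_integral_pow_sub_le`). For `h(x) = ∫ f(x, y) κ(x, dy)`, long
partial sums of `∑_t (κ^t h - I)` are therefore bounded by a constant `C` and solve the Poisson
equation up to an arbitrarily small `δ` (`SatisfiesDoeblin.exists_approx_poisson`). With such a
partial sum `g`, the process `S_n + g(X_n)` has conditional drift at least `I - δ` at every step,
while up to the passage time it never rises above its start by more than `b + F + 2C`. Comparing the
two and letting `δ → 0` gives `𝔼[T(b)] ≤ (b + F + 2C) / I` for every initial law
(`lintegral_cusumTime_le`).

This exceeds `(b + μ) / I` by a constant, so it is at most `1 + n₀(b) + C'` and `ε(n) = C' / n`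
works as soon as `n₀(b) ≥ 1`. The latter always holds, because `lam ≤ 1` forces `μ ≥ F ≥ I`.
-/

/-! ### Uniform ergodicity and the Poisson equation -/

section Doeblin

variable {S : Type*} [MeasurableSpace S]

instance Kernel.isMarkovKernel_pow (κ : Kernel S S) [IsMarkovKernel κ] (n : ℕ) :
    IsMarkovKernel (κ ^ n) := by
  induction n with
  | zero =>
    rw [pow_zero]
    exact inferInstanceAs (IsMarkovKernel Kernel.id)
  | succ n ih =>
    rw [pow_succ]
    exact inferInstanceAs (IsMarkovKernel ((κ ^ n) ∘ₖ κ))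

theorem integrable_of_forall_mem_Icc {μ : Measure S} [IsFiniteMeasure μ] {h : S → ℝ}
    (hm : Measurable h) {a c : ℝ} (hh : ∀ x, h x ∈ Set.Icc a c) : Integrable h μ :=
  Integrable.of_mem_Icc a c hm.aemeasurable (ae_of_all _ hh)

theorem integral_mem_Icc {μ : Measure S} [IsProbabilityMeasure μ] {h : S → ℝ}
    (hm : Measurable h) {a c : ℝ} (hh : ∀ x, h x ∈ Set.Icc a c) : ∫ x, h x ∂μ ∈ Set.Icc a c := by
  have hi : Integrable h μ := integrable_of_forall_mem_Icc hm hh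
  constructor
  · simpa using integral_mono (integrable_const a) hi fun x => (hh x).1
  · simpa using integral_mono hi (integrable_const c) fun x => (hh x).2

theorem measurable_integral_kernel_pow (κ : Kernel S S) [IsMarkovKernel κ] {h : S → ℝ}
    (hm : Measurable h) (n : ℕ) : Measurable fun x => ∫ y, h y ∂(κ ^ n) x :=
  hm.stronglyMeasurable.integral_kernel.measurable

theorem integral_kernel_pow_add (κ : Kernel S S) [IsMarkovKernel κ] {h : S → ℝ}
    (hm : Measurable h) {a c : ℝ} (hh : ∀ x, h x ∈ Set.Icc a c) (n k : ℕ) (x : S) :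
    ∫ y, h y ∂(κ ^ (n + k)) x = ∫ z, ∫ y, h y ∂(κ ^ n) z ∂(κ ^ k) x := by
  have := Kernel.isMarkovKernel_pow κ (n + k)
  rw [Kernel.pow_add] at this ⊢
  exact Kernel.integral_comp (integrable_of_forall_mem_Icc hm hh)

theorem integral_integral_kernel_pow_of_invariant {κ : Kernel S S} [IsMarkovKernel κ]
    {π : Measure S} [IsProbabilityMeasure π] (hπ : κ.Invariant π) {h : S → ℝ}
    (hm : Measurable h) {a c : ℝ} (hh : ∀ x, h x ∈ Set.Icc a c) (n : ℕ) :
    ∫ x, ∫ y, h y ∂(κ ^ n) x ∂π = ∫ y, h y ∂π := by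
  have hn : (κ ^ n).Invariant π := by
    induction n with
    | zero =>
      rw [pow_zero]
      exact (Measure.id_comp : Kernel.id ∘ₘ π = π)
    | succ n ih =>
      rw [pow_succ]
      exact ih.comp hπ
  have hi : Integrable h π := integrable_of_forall_mem_Icc hm hh
  rw [← hn.def, Measure.comp_eq_comp_const_apply] at hi
  conv_rhs => rw [← hn.def, Measure.comp_eq_comp_const_apply, Kernel.integral_comp hi]
  rw [Kernel.const_apply]

theorem SatisfiesDoeblin.le_one [Nonempty S] {κ : Kernel S S} [IsMarkovKernel κ] {l : ℕ} {lam : ℝ}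
    (hκ : SatisfiesDoeblin κ l lam) : lam ≤ 1 := by
  obtain ⟨-, -, φ, _, hφ⟩ := hκ
  have h := hφ (Classical.arbitrary S) Set.univ
  simpa using h

/-- Contraction of oscillations: `l` steps of the kernel map functions with values in an interval to
functions with values in an interval shorter by the factor `1 - lam`. -/
theorem SatisfiesDoeblin.exists_integral_mem_Icc {κ : Kernel S S} [IsMarkovKernel κ] {l : ℕ}
    {lam : ℝ} (hκ : SatisfiesDoeblin κ l lam) {h : S → ℝ} (hm : Measurable h) {a c : ℝ}
    (hh : ∀ x, h x ∈ Set.Icc a c) :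
    ∃ a' c', c' - a' = (1 - lam) * (c - a) ∧ ∀ x, ∫ y, h y ∂(κ ^ l) x ∈ Set.Icc a' c' := by
  obtain ⟨-, hlam, φ, _, hφ⟩ := hκ
  have key : ∀ (x : S) (u : S → ℝ), Measurable u → (∀ y, u y ∈ Set.Icc 0 (c - a)) →
      lam * ∫ y, u y ∂φ ≤ ∫ y, u y ∂(κ ^ l) x := by
    intro x u hu hu'
    have := integral_mono_measure (hφ x) (ae_of_all _ fun y => (hu' y).1)
      (integrable_of_forall_mem_Icc hu hu')
    rwa [integral_smul_measure, ENNReal.toReal_ofReal hlam.le, smul_eq_mul] at this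
  have hi : ∀ μ : Measure S, IsProbabilityMeasure μ → Integrable h μ := fun μ _ =>
    integrable_of_forall_mem_Icc hm hh
  -- the new endpoints come from `κ^l x ≥ lam • φ`, applied to the nonnegative `h - a` and `c - h`
  refine ⟨a + lam * (∫ y, h y ∂φ - a), c - lam * (c - ∫ y, h y ∂φ), by ring, fun x => ?_⟩
  have h1 := key x (fun y => h y - a) (by fun_prop) fun y => by
    have := hh y; constructor <;> linarith [this.1, this.2]
  have h2 := key x (fun y => c - h y) (by fun_prop) fun y => by
    have := hh y; constructor <;> linarith [this.1, this.2]
  rw [integral_sub (hi _ inferInstance) (integrable_const _),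
    integral_sub (hi _ inferInstance) (integrable_const _)] at h1
  rw [integral_sub (integrable_const _) (hi _ inferInstance),
    integral_sub (integrable_const _) (hi _ inferInstance)] at h2
  simp only [integral_const, probReal_univ, one_smul] at h1 h2
  constructor <;> linarith

/-- Geometric convergence to the stationary mean, in blocks of `l` steps: `π` averages `κ^n h`
to `∫ h ∂π`, so this mean lies in every interval that contains the values of `κ^n h`. -/
theorem SatisfiesDoeblin.abs_integral_pow_sub_le {κ : Kernel S S} [IsMarkovKernel κ] {l : ℕ}
    {lam : ℝ} (hκ : SatisfiesDoeblin κ l lam) {π : Measure S} [IsProbabilityMeasure π]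
    (hπ : κ.Invariant π) {h : S → ℝ} (hm : Measurable h) {a c : ℝ}
    (hh : ∀ x, h x ∈ Set.Icc a c) (j r : ℕ) (x : S) :
    |∫ y, h y ∂(κ ^ (l * j + r)) x - ∫ y, h y ∂π| ≤ (1 - lam) ^ j * (c - a) := by
  have hblock : ∀ j : ℕ, ∃ a' c', c' - a' = (1 - lam) ^ j * (c - a) ∧
      ∀ x, ∫ y, h y ∂(κ ^ (l * j)) x ∈ Set.Icc a' c' := by
    intro j
    induction j with
    | zero =>
      refine ⟨a, c, by simp, fun x => ?_⟩
      exact integral_mem_Icc hm hh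
    | succ j ih =>
      obtain ⟨a', c', hac, hin⟩ := ih
      obtain ⟨a'', c'', hac', hin'⟩ :=
        hκ.exists_integral_mem_Icc (measurable_integral_kernel_pow κ hm (l * j)) hin
      refine ⟨a'', c'', by rw [hac', hac]; ring, fun x => ?_⟩
      rw [mul_add_one, integral_kernel_pow_add κ hm hh]
      exact hin' x
  obtain ⟨a', c', hac, hin⟩ := hblock j
  have hin' : ∀ x, ∫ y, h y ∂(κ ^ (l * j + r)) x ∈ Set.Icc a' c' := fun x => by
    rw [integral_kernel_pow_add κ hm hh]
    exact integral_mem_Icc (measurable_integral_kernel_pow κ hm _) hin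
  have hI := integral_mem_Icc (μ := π) (measurable_integral_kernel_pow κ hm (l * j + r)) hin'
  rw [integral_integral_kernel_pow_of_invariant hπ hm hh] at hI
  rw [← hac, abs_le]
  constructor <;> linarith [(hin' x).1, (hin' x).2, hI.1, hI.2]

theorem sum_range_mul_le_of_block_geometric {u : ℕ → ℝ} {l : ℕ} {lam K : ℝ} (hlam : 0 < lam)
    (hlam1 : lam ≤ 1) (hK : 0 ≤ K) (hu : ∀ j r, u (l * j + r) ≤ (1 - lam) ^ j * K) (k : ℕ) :
    ∑ t ∈ Finset.range (l * k), u t ≤ l * K / lam := by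
  -- the partial geometric sum is `(1 - (1 - lam) ^ k) / lam`
  have h : ∑ t ∈ Finset.range (l * k), u t ≤ l * K * (1 - (1 - lam) ^ k) / lam := by
    induction k with
    | zero => simp
    | succ k ih =>
      rw [mul_add_one, Finset.sum_range_add]
      have : ∑ r ∈ Finset.range l, u (l * k + r) ≤ l * ((1 - lam) ^ k * K) := by
        simpa using Finset.sum_le_card_nsmul (Finset.range l) _ _ fun r _ => hu k r
      calc _ ≤ l * K * (1 - (1 - lam) ^ k) / lam + l * ((1 - lam) ^ k * K) := add_le_add ih this
        _ = _ := by field_simp; ring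
  have hpow : 0 ≤ (1 - lam) ^ k := pow_nonneg (sub_nonneg.2 hlam1) _
  exact h.trans <| div_le_div_of_nonneg_right
    (mul_le_of_le_one_right (by positivity) (by linarith)) hlam.le

/-- Approximate Poisson equation. The bound `C` does not depend on the error `δ`; the solution is a
partial sum of `∑ t, (κ^t h - ∫ h ∂π)` over whole blocks of `l` terms, and only the lower estimate
on the drift is recorded. -/
theorem SatisfiesDoeblin.exists_approx_poisson [Nonempty S] {κ : Kernel S S} [IsMarkovKernel κ]
    {l : ℕ} {lam : ℝ} (hκ : SatisfiesDoeblin κ l lam) {π : Measure S} [IsProbabilityMeasure π]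
    (hπ : κ.Invariant π) {h : S → ℝ} (hm : Measurable h) {a c : ℝ}
    (hh : ∀ x, h x ∈ Set.Icc a c) :
    ∃ C : ℝ, ∀ δ > 0, ∃ g : S → ℝ, Measurable g ∧ (∀ x, |g x| ≤ C) ∧
      ∀ x, ∫ y, h y ∂π - δ ≤ h x + ∫ y, g y ∂κ x - g x := by
  have hlam := hκ.2.1
  have hlam1 := hκ.le_one
  have hac : 0 ≤ c - a := by
    have := hh (Classical.arbitrary S); linarith [this.1, this.2]
  refine ⟨l * (c - a) / lam, fun δ hδ => ?_⟩
  obtain ⟨k, hk⟩ : ∃ k : ℕ, (1 - lam) ^ k * (c - a) < δ := by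
    have : Tendsto (fun k : ℕ => (1 - lam) ^ k * (c - a)) atTop (𝓝 (0 * (c - a))) :=
      (tendsto_pow_atTop_nhds_zero_of_lt_one (by linarith) (by linarith)).mul_const _
    rw [zero_mul] at this
    exact (this.eventually_lt_const hδ).exists
  have hUm := measurable_integral_kernel_pow κ hm
  have hU : ∀ n x, ∫ y, h y ∂(κ ^ n) x ∈ Set.Icc a c := fun n x => integral_mem_Icc hm hh
  refine ⟨fun x => ∑ t ∈ Finset.range (l * k), (∫ y, h y ∂(κ ^ t) x - ∫ y, h y ∂π),
    Finset.measurable_fun_sum _ fun t _ => (hUm t).sub_const _, fun x => ?_, fun x => ?_⟩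
  · exact (Finset.abs_sum_le_sum_abs _ _).trans <| sum_range_mul_le_of_block_geometric hlam hlam1
      hac (fun j r => hκ.abs_integral_pow_sub_le hπ hm hh j r x) k
  · have hint : ∀ t, Integrable (fun z => ∫ y, h y ∂(κ ^ t) z) (κ x) := fun t =>
      integrable_of_forall_mem_Icc (hUm t) (hU t)
    have hstep : ∀ t, ∫ z, ∫ y, h y ∂(κ ^ t) z ∂κ x = ∫ y, h y ∂(κ ^ (t + 1)) x := fun t => by
      rw [integral_kernel_pow_add κ hm hh, pow_one]
    have h0 : ∫ y, h y ∂(κ ^ 0) x = h x := by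
      rw [pow_zero]
      exact Kernel.integral_deterministic' measurable_id hm.stronglyMeasurable
    beta_reduce
    rw [integral_finsetSum _ fun t _ => (hint t).sub' (integrable_const _)]
    simp_rw [integral_sub (hint _) (integrable_const _), hstep, integral_const, probReal_univ,
      one_smul]
    have htel := Finset.sum_range_sub (fun t => ∫ y, h y ∂(κ ^ t) x) (l * k)
    have hlast := (abs_le.1 (hκ.abs_integral_pow_sub_le hπ hm hh k 0 x)).1
    rw [add_zero] at hlast
    simp only [Finset.sum_sub_distrib] at htel ⊢
    linarith

end Doeblin

/-! ### Expected first passage times -/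

section FirstPassage

variable {S Ω : Type*}

/-- The event that the partial sums `∑_{i < k} f(X_i, X_{i+1})` are below `b` for all `k ≤ n`,
the empty sum `k = 0` included. For `b > 0` it says that the first passage time of the partial sums
over the level `b` exceeds `n`. -/
def belowUpTo (f : S × S → ℝ) (X : ℕ → Ω → S) (b : ℝ) (n : ℕ) : Set Ω :=
  {ω | ∀ k ≤ n, ∑ i ∈ Finset.range k, f (X i ω, X (i + 1) ω) < b}

/-- The CUSUM time is at most the first passage time, here written as the sum of the indicators
of the events that it exceeds `n`. -/
theorem cusumTime_le_tsum_indicator (f : S × S → ℝ) (X : ℕ → Ω → S) {b : ℝ} (hb : 0 < b) (ω : Ω) :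
    (cusumTime f X b ω : ℝ≥0∞) ≤ ∑' n, (belowUpTo f X b n).indicator 1 ω := by
  classical
  by_cases h : ∃ n, ω ∉ belowUpTo f X b n
  · have hn := Nat.find_spec h
    have hmin : ∀ j < Nat.find h, ω ∈ belowUpTo f X b j := fun j hj => not_not.1 (Nat.find_min h hj)
    set n := Nat.find h
    obtain ⟨k, hkn, hk⟩ : ∃ k ≤ n, b ≤ ∑ i ∈ Finset.range k, f (X i ω, X (i + 1) ω) := by
      simpa [belowUpTo] using hn
    have hk1 : 1 ≤ k := by
      rcases Nat.eq_zero_or_pos k with rfl | h0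
      · simp at hk; linarith
      · exact h0
    have hsum : ∑ i ∈ Finset.Icc 1 k, f (X (i - 1) ω, X i ω)
        = ∑ i ∈ Finset.range k, f (X i ω, X (i + 1) ω) := by
      rw [Finset.range_eq_Ico]
      exact (Finset.sum_Ico_add' (fun i => f (X (i - 1) ω, X i ω)) 0 k 1).symm
    have hle : cusumTime f X b ω ≤ k := iInf₂_le k ⟨1, le_rfl, hk1, hsum ▸ hk⟩
    calc (cusumTime f X b ω : ℝ≥0∞) ≤ ((k : ℕ∞) : ℝ≥0∞) := ENat.toENNReal_le.2 hle
      _ ≤ (n : ℝ≥0∞) := by simpa using hkn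
      _ = ∑ j ∈ Finset.range n, (belowUpTo f X b j).indicator 1 ω := by
        rw [Finset.sum_congr rfl fun j hj =>
          Set.indicator_of_mem (hmin j (Finset.mem_range.1 hj)) (1 : Ω → ℝ≥0∞)]
        simp
      _ ≤ _ := ENNReal.sum_le_tsum _
  · push Not at h
    have : ∑' n, (belowUpTo f X b n).indicator (1 : Ω → ℝ≥0∞) ω = ⊤ := by
      simp_rw [Set.indicator_of_mem (h _) (1 : Ω → ℝ≥0∞)]
      simp
    rw [this]
    exact le_top

/-- The sum telescopes to the increment of `∑_{i < k} f(X_i, X_{i+1}) + g(X_k)` between time `0` and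
the minimum of `N` and the passage time; the overshoot over `b` is at most one increment of `f`. -/
theorem sum_indicator_belowUpTo_le {f : S × S → ℝ} {X : ℕ → Ω → S} {b F C : ℝ} (hb : 0 < b)
    (hf : ∀ B, |f B| ≤ F) {g : S → ℝ} (hg : ∀ x, |g x| ≤ C) (N : ℕ) (ω : Ω) :
    ∑ n ∈ Finset.range N, (belowUpTo f X b n).indicator
      (fun ω => f (X n ω, X (n + 1) ω) + g (X (n + 1) ω) - g (X n ω)) ω ≤ b + F + 2 * C := by
  have hC : ∀ n m, g (X n ω) - g (X m ω) ≤ 2 * C := fun n m => by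
    linarith [(abs_le.1 (hg (X n ω))).2, (abs_le.1 (hg (X m ω))).1]
  have hF : 0 ≤ F := (abs_nonneg _).trans (hf (X 0 ω, X 0 ω))
  have key : ∀ N, (∀ n < N, ω ∈ belowUpTo f X b n) →
      ∑ n ∈ Finset.range N, (belowUpTo f X b n).indicator
        (fun ω => f (X n ω, X (n + 1) ω) + g (X (n + 1) ω) - g (X n ω)) ω
      = ∑ n ∈ Finset.range N, f (X n ω, X (n + 1) ω) + (g (X N ω) - g (X 0 ω)) := by
    intro N hN
    rw [Finset.sum_congr rfl fun n hn => Set.indicator_of_mem (hN n (Finset.mem_range.1 hn)) _,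
      ← Finset.sum_range_sub (fun n => g (X n ω)), ← Finset.sum_add_distrib]
    exact Finset.sum_congr rfl fun n _ => by ring
  induction N with
  | zero => simp; linarith [hC 0 0]
  | succ N ih =>
    by_cases hω : ω ∈ belowUpTo f X b N
    · rw [key (N + 1) fun n hn k hk => hω k (hk.trans (Nat.le_of_lt_succ hn)),
        Finset.sum_range_succ]
      linarith [hω N le_rfl, hC (N + 1) 0, (abs_le.1 (hf (X N ω, X (N + 1) ω))).2]
    · rw [Finset.sum_range_succ, Set.indicator_of_notMem hω, add_zero]
      exact ih

variable [MeasurableSpace S]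

/-- `belowUpTo f X b n` is determined by `X_0, …, X_n`, that is, first passage is a stopping time. -/
theorem exists_measurableSet_preimage_eq_belowUpTo {f : S × S → ℝ} (hf : Measurable f)
    (X : ℕ → Ω → S) (b : ℝ) (n : ℕ) :
    ∃ B : Set (Fin (n + 1) → S), MeasurableSet B ∧
      (fun ω (i : Fin (n + 1)) => X i ω) ⁻¹' B = belowUpTo f X b n := by
  refine ⟨{x | ∀ k ≤ n, ∑ i ∈ Finset.range k,
    f (x (Fin.ofNat (n + 1) i), x (Fin.ofNat (n + 1) (i + 1))) < b}, ?_, ?_⟩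
  · simp only [Set.ofPred_forall]
    refine MeasurableSet.iInter fun k => MeasurableSet.iInter fun _ => ?_
    exact measurableSet_lt (by fun_prop) measurable_const
  · ext ω
    refine forall₂_congr fun k hk => ?_
    rw [Finset.sum_congr rfl fun i hi => ?_]
    have := Finset.mem_range.1 hi
    simp only [Fin.val_ofNat]
    rw [Nat.mod_eq_of_lt (by omega), Nat.mod_eq_of_lt (by omega)]

theorem measurableSet_belowUpTo [MeasurableSpace Ω] {f : S × S → ℝ} (hf : Measurable f)
    {X : ℕ → Ω → S} (hX : ∀ n, Measurable (X n)) (b : ℝ) (n : ℕ) :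
    MeasurableSet (belowUpTo f X b n) := by
  obtain ⟨B, hB, hBA⟩ := exists_measurableSet_preimage_eq_belowUpTo hf X b n
  rw [← hBA]
  exact hB.preimage (measurable_pi_lambda _ fun i => hX i)

variable [MeasurableSpace Ω] {Pr : Measure Ω} [IsProbabilityMeasure Pr]

/-- If `u(x, ·)` has nonnegative mean under `κ x` for every `x`, then `u(X_n, X_{n+1})` has nonnegative
integral over every event determined by `X_0, …, X_n`. -/
theorem setIntegral_transition_nonneg {κ : Kernel S S} [IsMarkovKernel κ] {X : ℕ → Ω → S} {n : ℕ}
    (hX : HasCondDistrib (X (n + 1)) (fun ω (i : Fin (n + 1)) => X i ω)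
      (κ.comap (fun h : Fin (n + 1) → S => h (Fin.last n)) (measurable_pi_apply _)) Pr)
    {u : S × S → ℝ} (hu : Measurable u) {K : ℝ} (hK : ∀ B, |u B| ≤ K)
    (hu0 : ∀ x, 0 ≤ ∫ y, u (x, y) ∂κ x) {B : Set (Fin (n + 1) → S)} (hB : MeasurableSet B) :
    0 ≤ ∫ ω in (fun ω (i : Fin (n + 1)) => X i ω) ⁻¹' B, u (X n ω, X (n + 1) ω) ∂Pr := by
  have hprob : IsProbabilityMeasure (Pr.map fun ω (i : Fin (n + 1)) => X i ω) :=
    Measure.isProbabilityMeasure_map hX.aemeasurable_fst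
  let v : (Fin (n + 1) → S) × S → ℝ := fun z => u (z.1 (Fin.last n), z.2)
  have hv : Measurable v := by fun_prop
  have hvi : Integrable v ((Pr.map fun ω (i : Fin (n + 1)) => X i ω) ⊗ₘ
      κ.comap (fun h : Fin (n + 1) → S => h (Fin.last n)) (measurable_pi_apply _)) :=
    integrable_of_forall_mem_Icc hv fun z => abs_le.1 (hK _)
  have hmap := setIntegral_map (μ := Pr) (hB.prod MeasurableSet.univ) hv.aestronglyMeasurable
    hX.aemeasurable
  rw [hX.map_eq, Measure.setIntegral_compProd hB MeasurableSet.univ hvi.integrableOn] at hmap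
  have hset : (fun ω => ((fun i : Fin (n + 1) => X i ω), X (n + 1) ω)) ⁻¹' (B ×ˢ Set.univ)
      = (fun ω (i : Fin (n + 1)) => X i ω) ⁻¹' B := by ext; simp
  rw [hset] at hmap
  have hnonneg : 0 ≤ ∫ a in B, ∫ y in Set.univ, v (a, y)
      ∂(κ.comap (fun h : Fin (n + 1) → S => h (Fin.last n)) (measurable_pi_apply _) a)
      ∂(Pr.map fun ω (i : Fin (n + 1)) => X i ω) := by
    refine integral_nonneg fun a => ?_
    simpa [v] using hu0 (a (Fin.last n))
  rw [hmap] at hnonneg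
  simpa [v] using hnonneg

/-- Wald type inequality: if `f(x, y) + g(y) - g(x)` has mean at least `η` under `κ x`, then the
passage time, truncated at `N`, has expectation at most `(b + F + 2 * C) / η` when `η > 0`. -/
theorem drift_mul_sum_belowUpTo_le {κ : Kernel S S} [IsMarkovKernel κ] {X : ℕ → Ω → S}
    (hXm : ∀ n, Measurable (X n))
    (hX : ∀ n, HasCondDistrib (X (n + 1)) (fun ω (i : Fin (n + 1)) => X i ω)
      (κ.comap (fun h : Fin (n + 1) → S => h (Fin.last n)) (measurable_pi_apply _)) Pr)
    {f : S × S → ℝ} (hfm : Measurable f) {F : ℝ} (hf : ∀ B, |f B| ≤ F)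
    {g : S → ℝ} (hgm : Measurable g) {C : ℝ} (hg : ∀ x, |g x| ≤ C) {η : ℝ}
    (hdrift : ∀ x, η ≤ ∫ y, f (x, y) ∂κ x + ∫ y, g y ∂κ x - g x)
    {b : ℝ} (hb : 0 < b) (N : ℕ) :
    η * ∑ n ∈ Finset.range N, Pr.real (belowUpTo f X b n) ≤ b + F + 2 * C := by
  have hA : ∀ n, MeasurableSet (belowUpTo f X b n) := measurableSet_belowUpTo hfm hXm b
  let w : ℕ → Ω → ℝ := fun n ω => f (X n ω, X (n + 1) ω) + g (X (n + 1) ω) - g (X n ω)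
  have hwi : ∀ n, Integrable (w n) Pr := fun n =>
    integrable_of_forall_mem_Icc (a := -(F + 2 * C)) (c := F + 2 * C) (by fun_prop) fun ω => by
      have h1 := abs_le.1 (hf (X n ω, X (n + 1) ω))
      have h2 := abs_le.1 (hg (X n ω))
      have h3 := abs_le.1 (hg (X (n + 1) ω))
      constructor <;> simp only [w] <;> linarith [h1.1, h1.2, h2.1, h2.2, h3.1, h3.2]
  have hstep : ∀ n, η * Pr.real (belowUpTo f X b n) ≤ ∫ ω in belowUpTo f X b n, w n ω ∂Pr := by
    intro n
    obtain ⟨B, hB, hBA⟩ := exists_measurableSet_preimage_eq_belowUpTo hfm X b n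
    have h := setIntegral_transition_nonneg (hX n) (u := fun z => f z + g z.2 - g z.1 - η)
      (K := F + 2 * C + |η|) (by fun_prop) (fun z => by
        have h1 := abs_le.1 (hf z)
        have h2 := abs_le.1 (hg z.1)
        have h3 := abs_le.1 (hg z.2)
        have h4 := abs_le.1 (le_refl |η|)
        rw [abs_le]
        constructor <;> linarith [h1.1, h1.2, h2.1, h2.2, h3.1, h3.2, h4.1, h4.2])
      (fun x => by
        have i1 : Integrable (fun y => f (x, y)) (κ x) :=
          integrable_of_forall_mem_Icc (by fun_prop) fun y => abs_le.1 (hf _)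
        have i2 : Integrable g (κ x) :=
          integrable_of_forall_mem_Icc hgm fun y => abs_le.1 (hg _)
        have i3 : Integrable (fun y => f (x, y) + g y) (κ x) := i1.add i2
        have i4 : Integrable (fun y => f (x, y) + g y - g x) (κ x) := i3.sub (integrable_const _)
        rw [integral_sub i4 (integrable_const _), integral_sub i3 (integrable_const _),
          integral_add i1 i2]
        simpa using hdrift x) hB
    rw [hBA] at h
    have h' : 0 ≤ ∫ ω in belowUpTo f X b n, (w n ω - η) ∂Pr := h
    rw [integral_sub (hwi n).integrableOn (integrable_const _), setIntegral_const,
      smul_eq_mul] at h'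
    linarith
  calc η * ∑ n ∈ Finset.range N, Pr.real (belowUpTo f X b n)
      ≤ ∑ n ∈ Finset.range N, ∫ ω in belowUpTo f X b n, w n ω ∂Pr := by
        rw [Finset.mul_sum]; exact Finset.sum_le_sum fun n _ => hstep n
    _ = ∫ ω, ∑ n ∈ Finset.range N, (belowUpTo f X b n).indicator (w n) ω ∂Pr := by
        rw [integral_finsetSum _ fun n _ => (hwi n).indicator (hA n)]
        exact Finset.sum_congr rfl fun n _ => (integral_indicator (hA n)).symm
    _ ≤ ∫ _, (b + F + 2 * C) ∂Pr :=
        integral_mono (integrable_finsetSum _ fun n _ => (hwi n).indicator (hA n))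
          (integrable_const _) fun ω => sum_indicator_belowUpTo_le hb hf hg N ω
    _ = b + F + 2 * C := by simp

/-- The approximate solutions of the Poisson equation share the bound `C`, so that the errors `δ`
may tend to zero in the Wald type inequality. -/
theorem lintegral_cusumTime_le {κ : Kernel S S} [IsMarkovKernel κ] {X : ℕ → Ω → S}
    (hXm : ∀ n, Measurable (X n))
    (hX : ∀ n, HasCondDistrib (X (n + 1)) (fun ω (i : Fin (n + 1)) => X i ω)
      (κ.comap (fun h : Fin (n + 1) → S => h (Fin.last n)) (measurable_pi_apply _)) Pr)
    {f : S × S → ℝ} (hfm : Measurable f) {F : ℝ} (hf : ∀ B, |f B| ≤ F) {C I : ℝ} (hI : 0 < I)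
    (hpoisson : ∀ δ > 0, ∃ g : S → ℝ, Measurable g ∧ (∀ x, |g x| ≤ C) ∧
      ∀ x, I - δ ≤ ∫ y, f (x, y) ∂κ x + ∫ y, g y ∂κ x - g x)
    {b : ℝ} (hb : 0 < b) :
    ∫⁻ ω, (cusumTime f X b ω : ℝ≥0∞) ∂Pr ≤ ENNReal.ofReal ((b + F + 2 * C) / I) := by
  have hA : ∀ n, MeasurableSet (belowUpTo f X b n) := measurableSet_belowUpTo hfm hXm b
  calc ∫⁻ ω, (cusumTime f X b ω : ℝ≥0∞) ∂Pr
      ≤ ∫⁻ ω, ∑' n, (belowUpTo f X b n).indicator 1 ω ∂Pr :=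
        lintegral_mono fun ω => cusumTime_le_tsum_indicator f X hb ω
    _ = ∑' n, Pr (belowUpTo f X b n) := by
        rw [lintegral_tsum fun n => (measurable_one.indicator (hA n)).aemeasurable]
        exact tsum_congr fun n => lintegral_indicator_one (hA n)
    _ ≤ ENNReal.ofReal ((b + F + 2 * C) / I) := by
        refine ENNReal.tsum_le_of_sum_range_le fun N => ?_
        have hsum : I * ∑ n ∈ Finset.range N, Pr.real (belowUpTo f X b n) ≤ b + F + 2 * C := by
          set s := ∑ n ∈ Finset.range N, Pr.real (belowUpTo f X b n)
          have hlim : Tendsto (fun δ : ℝ => (I - δ) * s) (𝓝[>] 0) (𝓝 ((I - 0) * s)) :=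
            (Continuous.tendsto (by fun_prop) 0).mono_left nhdsWithin_le_nhds
          rw [sub_zero] at hlim
          refine le_of_tendsto hlim (eventually_mem_nhdsWithin.mono fun δ hδ => ?_)
          obtain ⟨g, hgm, hg, hdrift⟩ := hpoisson δ hδ
          exact drift_mul_sum_belowUpTo_le hXm hX hfm hf hgm hg hdrift hb N
        calc ∑ n ∈ Finset.range N, Pr (belowUpTo f X b n)
            = ENNReal.ofReal (∑ n ∈ Finset.range N, Pr.real (belowUpTo f X b n)) := by
              rw [ENNReal.ofReal_sum_of_nonneg fun _ _ => measureReal_nonneg]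
              simp
          _ ≤ _ := ENNReal.ofReal_le_ofReal ((le_div_iff₀' hI).2 hsum)

end FirstPassage

/-! ### Truncation and the bound for the CUSUM time -/

section Truncation

theorem abs_truncate_le {M : ℝ} (hM : 0 ≤ M) (x : ℝ) : |truncate M x| ≤ M := by
  unfold truncate
  split_ifs with h1 h2
  · exact h1
  · exact (abs_of_nonneg hM).le
  · rw [abs_neg, abs_of_nonneg hM]

theorem measurable_truncate (M : ℝ) : Measurable (truncate M) :=
  Measurable.ite (measurableSet_le measurable_id.abs measurable_const) measurable_id <|
    Measurable.ite (measurableSet_lt measurable_const measurable_id) measurable_const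
      measurable_const

end Truncation

theorem theorem2 {d : ℕ} {m : Measure (EuclideanSpace ℝ (Fin d))} [SFinite m]
    (p q : TransitionDensity m) (hs : Measurable (scoreDiff p q))
    -- the post-change kernel is uniformly ergodic, with stationary distribution `π`
    (hQ : ∃ (l : ℕ) (lam : ℝ), SatisfiesDoeblin q.kernel l lam)
    (π : Measure (EuclideanSpace ℝ (Fin d))) [IsProbabilityMeasure π]
    (hπ : q.kernel.Invariant π)
    -- Doeblin constants of the pair chain under the post-change kernel
    (l : ℕ) (lam : ℝ) (hl : SatisfiesDoeblin (pairKernel q.kernel) l lam)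
    -- truncation level, with positive truncated drift
    (M : ℝ) (hM : 0 < M) (hI : 0 < stationaryDrift π q.kernel (truncScore p q M))
    -- the observations, with change point `1` and any initial law
    {Ω : Type*} [MeasurableSpace Ω] (Pr : Measure Ω) [IsProbabilityMeasure Pr]
    (ρ : Measure (EuclideanSpace ℝ (Fin d))) [IsProbabilityMeasure ρ]
    (X : ℕ → Ω → EuclideanSpace ℝ (Fin d))
    (hX : IsChangePointProcess p.kernel q.kernel ρ 1 X Pr)
    (n₀ : ℝ → ℕ)
    (hn₀ : ∀ b, n₀ b = ⌊(b + hoeffdingConst (truncScore p q M) l lam) /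
      stationaryDrift π q.kernel (truncScore p q M)⌋₊) :
    ∃ ε : ℕ → ℝ, Tendsto ε atTop (𝓝 0) ∧ ∀ b : ℝ, 0 < b →
      ∫⁻ ω, (cusumTime (truncScore p q M) X b ω : ℝ≥0∞) ∂Pr ≤
        ENNReal.ofReal (1 + (n₀ b : ℝ) * (1 + ε (n₀ b))) := by
  obtain ⟨l', lam', hQ⟩ := hQ
  set f := truncScore p q M with hf_def
  set I := stationaryDrift π q.kernel f with hI_def
  set F := ⨆ B, |f B| with hF_def
  set c := hoeffdingConst f l lam with hc_def
  have hfm : Measurable f := (measurable_truncate M).comp hs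
  have hbdd : BddAbove (Set.range fun B => |f B|) :=
    ⟨M, Set.forall_mem_range.2 fun B => abs_truncate_le hM.le _⟩
  have hf : ∀ B, |f B| ≤ F := fun B => le_ciSup hbdd B
  have hIF : I ≤ F := (integral_mem_Icc hfm fun B => abs_le.1 (hf B)).2
  have : IsMarkovKernel (pairKernel q.kernel) := by unfold pairKernel; infer_instance
  -- the Doeblin constant `lam` is at most `1`, hence the constant `c` dominates the drift
  have hcI : I ≤ c := by
    have hF : 0 < F := hI.trans_le hIF
    refine hIF.trans ?_
    rw [hc_def, hoeffdingConst, ← hF_def, le_div_iff₀ hl.2.1]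
    have hl0 : (0 : ℝ) ≤ l := l.cast_nonneg
    nlinarith [hl.le_one, mul_nonneg hl0 hF.le]
  let h : EuclideanSpace ℝ (Fin d) → ℝ := fun x => ∫ y, f (x, y) ∂q.kernel x
  have hhm : Measurable h := hfm.stronglyMeasurable.integral_kernel_prod_right'.measurable
  have hhF : ∀ x, h x ∈ Set.Icc (-F) F := fun x =>
    integral_mem_Icc (by fun_prop) fun y => abs_le.1 (hf _)
  have hhI : ∫ x, h x ∂π = I :=
    (Measure.integral_compProd (integrable_of_forall_mem_Icc hfm fun B => abs_le.1 (hf B))).symm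
  obtain ⟨C, hC⟩ := hQ.exists_approx_poisson hπ hhm hhF
  rw [hhI] at hC
  have htr := hX.transition
  -- with change point `1` every transition is post-change, as `n + 1 < 1` never holds
  simp only [Nat.not_lt.2 (Nat.le_add_left 1 _), if_false] at htr
  refine ⟨fun n => (F + 2 * C - c) / I / n, tendsto_const_div_atTop_nhds_zero_nat _,
    fun b hb => ?_⟩
  refine (lintegral_cusumTime_le hX.measurable htr hfm hf hI hC hb).trans
    (ENNReal.ofReal_le_ofReal ?_)
  -- the value `ε 0` is the junk value `C' / 0 = 0`, and `n₀ b = 0` must be excluded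
  have hpos : 0 < n₀ b := by
    rw [hn₀, Nat.floor_pos, one_le_div hI]
    linarith
  have hlt : (b + c) / I < n₀ b + 1 := by
    rw [hn₀]; exact Nat.lt_floor_add_one _
  have hne : (n₀ b : ℝ) ≠ 0 := by positivity
  calc (b + F + 2 * C) / I = (b + c) / I + (F + 2 * C - c) / I := by ring
    _ ≤ (n₀ b + 1) + (F + 2 * C - c) / I := by gcongr
    _ = 1 + n₀ b * (1 + (F + 2 * C - c) / I / n₀ b) := by field_simp; ring
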